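/- **Theorem.** Let $\alpha$ be a real quadratic irrationality (a real number of degree two over $\mathbb Q$), with regular continued fraction $[a_0;a_1,a_2,\ldots]$. Call a finite sequence a *cyclic palindrome* if, read back to front, it is a cyclic shift of itself, and call a finite sequence $(a_s,\ldots,a_{s+t-1})$ with $t\ge 1$ a *period* of the continued fraction if $a_{k+t}=a_k$ for all $k\ge s$. For real irrational $\alpha,\omega$ write $\alpha\sim\omega$ if their continued fractions $[a_0;a_1,\ldots]$ and $[b_0;b_1,\ldots]$ have the same tails, i.e. there are $m,n\ge 0$ with $a_{m+k}=b_{n+k}$ for all $k\ge 0$. Denote by $\bar\omega$ the conjugate of a quadratic irrationality $\omega$, i.e. the other root of its minimal polynomial over $\mathbb Q$. The continued fraction of $\alpha$ has a period which is a cyclic palindrome if and only if at least one of the following statements holds: (a) $\alpha\sim\omega$ for some quadratic irrationality $\omega$ with $\omega+\bar\omega=0$ (i.e. $\omega^2\in\mathbb Q$); (b) $\alpha\sim\omega$ for some quadratic irrationality $\omega$ with $\omega+\bar\omega=1$ (i.e. $(\omega-1/2)^2\in\mathbb Q$); (c) $\alpha\sim\omega$ for some quadratic irrationality $\omega$ with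 $\omega\bar\omega=1$; (d) $\alpha\sim\omega$ for some quadratic irrationality $\omega$ with $\omega\bar\omega=-1$. Besides that, (b) is equivalent to (c). (In (a) and (b), "i.e." means that for every quadratic irrationality $\omega$ one has $\omega+\bar\omega=0\iff\omega^2\in\mathbb Q$ and $\omega+\bar\omega=1\iff(\omega-1/2)^2\in\mathbb Q$.) -/

import Mathlib

/-- A (real) quadratic irrationality: a real number of degree two over `ℚ`. -/
def IsQuadraticIrrationality (α : ℝ) : Prop :=
  (minpoly ℚ α).natDegree = 2

/-- `ω'` is the conjugate of the quadratic irrationality `ω`, i.e. the root different from `ω` of the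
minimal polynomial of `ω` over `ℚ`. -/
def IsQuadraticConjugate (ω ω' : ℝ) : Prop :=
  ω' ≠ ω ∧ IsConjRoot ℚ ω ω'

/-- The `n`-th partial quotient `aₙ` of the regular continued fraction `[a₀; a₁, a₂, …]` of `α`.
For irrational `α` the expansion never stops, so the default value `0` is not used. -/
noncomputable def partialQuotient (α : ℝ) (n : ℕ) : ℤ :=
  ((GenContFract.IntFractPair.stream α n).map GenContFract.IntFractPair.b).getD 0

/-- `α ∼ ω`: the continued fractions of `α` and `ω` have the same tails. -/
def TailEquivalent (α ω : ℝ) : Prop :=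
  ∃ m n : ℕ, ∀ k : ℕ, partialQuotient α (m + k) = partialQuotient ω (n + k)

/-- The finite sequence `l` is a cyclic palindrome: read back to front, it is a cyclic shift of
itself. -/
def IsCyclicPalindrome (l : List ℤ) : Prop :=
  l.IsRotated l.reverse

/-- The word `l` is a period of the (eventually) periodic sequence `u`: for some `s` and some `t ≥ 1`
the sequence is `t`-periodic from the index `s` on, and `l = (u s, …, u (s + t - 1))`. -/
def IsPeriodWord (u : ℕ → ℤ) (l : List ℤ) : Prop :=
  ∃ s t : ℕ, 0 < t ∧ (∀ k : ℕ, s ≤ k → u (k + t) = u k) ∧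
    l = List.ofFn (fun i : Fin t => u (s + i))

/-- The continued fraction of `α` has a cyclic palindromic period. -/
def HasCyclicPalindromicPeriod (α : ℝ) : Prop :=
  ∃ l : List ℤ, IsPeriodWord (partialQuotient α) l ∧ IsCyclicPalindrome l

/-- `α ∼ ω` for some quadratic irrationality `ω` that satisfies, together with its conjugate, the
relation `P ω ω'`. -/
def TailEquivalentToSome (α : ℝ) (P : ℝ → ℝ → Prop) : Prop :=
  ∃ ω ω' : ℝ, IsQuadraticIrrationality ω ∧ IsQuadraticConjugate ω ω' ∧
    TailEquivalent α ω ∧ P ω ω'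

/-! By Lagrange (`IsConjPair.exists_iterate_cfStep_eq`) a tail of the expansion extends to a
periodic two-sided sequence `w`. A cyclic palindromic period exists exactly when some such `w` has a
centre of symmetry, `w (c - k) = w k` (`hasCyclicPalindromicPeriod_iff`). By Galois
(`IsConjPair.partialQuotient_neg_inv`), if `ξ` is purely periodic with conjugate `ξ'`, then `-1/ξ'`
reads `w` backwards.

Each of the four relations makes the conjugate one of `-ω`, `1 - ω`, `1/ω`, `-1/ω`, hence tail
equivalent to `ω`. Then `w` and its reversal share a tail up to a shift, and periodicity turns this
into a symmetry of `w`.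

Conversely, take a complete quotient `ξ` starting at the centre. If the centre is an entry, the
successor of `ξ` equals `-1/ξ'`, so `ξ + ξ'` is an integer, and a translation makes it 0 or 1. If
the centre lies between two entries, `ξ = -1/ξ'`. An involutive Möbius map exchanges (b) and (c). -/

open GenContFract

/-! ### Complete quotients, and uniqueness of the expansion. -/

/-- One step of the continued fraction algorithm, `x ↦ 1 / {x}`. -/
noncomputable def cfStep (x : ℝ) : ℝ := (Int.fract x)⁻¹

theorem fract_ne_zero_of_irrational {x : ℝ} (hx : Irrational x) : Int.fract x ≠ 0 := by
  intro h
  exact hx ⟨⌊x⌋, by rw [Int.fract, sub_eq_zero] at h; push_cast; exact h.symm⟩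

theorem fract_pos_of_irrational {x : ℝ} (hx : Irrational x) : 0 < Int.fract x :=
  lt_of_le_of_ne (Int.fract_nonneg x) (fract_ne_zero_of_irrational hx).symm

theorem Irrational.cfStep {x : ℝ} (hx : Irrational x) : Irrational (cfStep x) := by
  unfold _root_.cfStep Int.fract
  exact (hx.sub_intCast _).inv

theorem Irrational.iterate_cfStep {x : ℝ} (hx : Irrational x) (n : ℕ) :
    Irrational (_root_.cfStep^[n] x) := by
  induction n with
  | zero => exact hx
  | succ n ih => rw [Function.iterate_succ_apply']; exact ih.cfStep

theorem one_lt_cfStep {x : ℝ} (hx : Irrational x) : 1 < cfStep x :=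
  (one_lt_inv₀ (fract_pos_of_irrational hx)).2 (Int.fract_lt_one x)

theorem eq_floor_add_inv_cfStep (x : ℝ) : x = ⌊x⌋ + (cfStep x)⁻¹ := by
  simp [cfStep]

theorem stream_eq_of_irrational {x : ℝ} (hx : Irrational x) (n : ℕ) :
    IntFractPair.stream x n = some (IntFractPair.of (cfStep^[n] x)) := by
  induction n with
  | zero => rfl
  | succ n ih =>
    have h : (IntFractPair.of (cfStep^[n] x)).fr ≠ 0 :=
      fract_ne_zero_of_irrational (hx.iterate_cfStep n)
    rw [IntFractPair.stream, ih, Function.iterate_succ_apply']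
    simp only [Option.bind_some, if_neg h]
    rfl

theorem partialQuotient_eq_floor {x : ℝ} (hx : Irrational x) (n : ℕ) :
    partialQuotient x n = ⌊cfStep^[n] x⌋ := by
  rw [partialQuotient, stream_eq_of_irrational hx]
  rfl

theorem partialQuotient_iterate_cfStep {x : ℝ} (hx : Irrational x) (m n : ℕ) :
    partialQuotient (cfStep^[m] x) n = partialQuotient x (m + n) := by
  rw [partialQuotient_eq_floor (hx.iterate_cfStep m), partialQuotient_eq_floor hx, add_comm m n,
    Function.iterate_add_apply]

theorem one_le_partialQuotient_succ {x : ℝ} (hx : Irrational x) (n : ℕ) :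
    1 ≤ partialQuotient x (n + 1) := by
  rw [partialQuotient_eq_floor hx, Function.iterate_succ_apply', Int.le_floor]
  exact_mod_cast (one_lt_cfStep (hx.iterate_cfStep n)).le

/-- A single step may expand by a factor close to 1. Over two steps, `ξ = a + 1/η` gives `ξη = aη +
1` with `a ≥ 1` and `η > 1`, which makes the expansion uniform. -/
theorem two_le_cfStep_mul_cfStep {x : ℝ} (hx : Irrational x) :
    2 ≤ cfStep x * cfStep (cfStep x) := by
  have h1 := one_lt_cfStep hx
  have h2 := one_lt_cfStep hx.cfStep
  have h3 : (1 : ℝ) ≤ ⌊cfStep x⌋ := by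
    exact_mod_cast Int.le_floor.2 (by exact_mod_cast h1.le)
  have h4 := eq_floor_add_inv_cfStep (cfStep x)
  have h5 : cfStep x * cfStep (cfStep x) = ⌊cfStep x⌋ * cfStep (cfStep x) + 1 := by
    have h6 : cfStep (cfStep x) ≠ 0 := by linarith
    nth_rewrite 1 [h4]
    rw [add_mul, inv_mul_cancel₀ h6]
  nlinarith

theorem abs_sub_eq_of_floor_eq {x y : ℝ} (hx : Irrational x) (hy : Irrational y)
    (h : ⌊x⌋ = ⌊y⌋) : |x - y| * (cfStep x * cfStep y) = |cfStep x - cfStep y| := by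
  have h1 := one_lt_cfStep hx
  have h2 := one_lt_cfStep hy
  have h3 : (x - y) * (cfStep x * cfStep y) = -(cfStep x - cfStep y) := by
    have : x - y = (cfStep x)⁻¹ - (cfStep y)⁻¹ := by
      conv_lhs => rw [eq_floor_add_inv_cfStep x, eq_floor_add_inv_cfStep y, h]
      ring
    rw [this]
    field_simp
    ring
  rw [← abs_neg (cfStep x - cfStep y), ← h3, abs_mul,
    abs_of_pos (mul_pos (by linarith) (by linarith) : 0 < cfStep x * cfStep y)]

theorem abs_sub_le_of_floor_eq {x y : ℝ} (hx : Irrational x) (hy : Irrational y)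
    (h : ⌊x⌋ = ⌊y⌋) (h' : ⌊cfStep x⌋ = ⌊cfStep y⌋) :
    4 * |x - y| ≤ |cfStep (cfStep x) - cfStep (cfStep y)| := by
  rw [← abs_sub_eq_of_floor_eq hx.cfStep hy.cfStep h', ← abs_sub_eq_of_floor_eq hx hy h]
  have h1 := two_le_cfStep_mul_cfStep hx
  have h2 := two_le_cfStep_mul_cfStep hy
  have h3 : (4 : ℝ) ≤ cfStep x * cfStep (cfStep x) * (cfStep y * cfStep (cfStep y)) := by
    nlinarith
  nlinarith [abs_nonneg (x - y)]

/-- Every two steps with equal partial quotients multiply the distance by at least 4, yet numbers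
with equal floors stay less than 1 apart. -/
theorem pow_mul_abs_sub_lt_one {n : ℕ} : ∀ {x y : ℝ}, Irrational x → Irrational y →
    (∀ k, partialQuotient x k = partialQuotient y k) → 4 ^ n * |x - y| < 1 := by
  induction n with
  | zero =>
    intro x y hx hy h
    have h0 := h 0
    rw [partialQuotient_eq_floor hx, partialQuotient_eq_floor hy] at h0
    simpa using Int.abs_sub_lt_one_of_floor_eq_floor h0
  | succ n ih =>
    intro x y hx hy h
    have h0 := h 0
    have h1 := h 1
    rw [partialQuotient_eq_floor hx, partialQuotient_eq_floor hy] at h0 h1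
    have h2 := abs_sub_le_of_floor_eq hx hy h0 h1
    have h3 := @ih (cfStep^[2] x) (cfStep^[2] y) (hx.iterate_cfStep 2) (hy.iterate_cfStep 2)
      (fun k => by
        rw [partialQuotient_iterate_cfStep hx, partialQuotient_iterate_cfStep hy, h])
    have h4 : (4 : ℝ) ^ n * (4 * |x - y|) ≤ 4 ^ n * |cfStep (cfStep x) - cfStep (cfStep y)| :=
      mul_le_mul_of_nonneg_left h2 (by positivity)
    calc (4 : ℝ) ^ (n + 1) * |x - y| = 4 ^ n * (4 * |x - y|) := by ring
      _ ≤ _ := h4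
      _ < 1 := h3

/-- An irrational number is determined by its continued fraction. -/
theorem eq_of_partialQuotient_eq {x y : ℝ} (hx : Irrational x) (hy : Irrational y)
    (h : ∀ k, partialQuotient x k = partialQuotient y k) : x = y := by
  by_contra hne
  have hpos : 0 < |x - y| := abs_pos.2 (sub_ne_zero.2 hne)
  obtain ⟨n, hn⟩ := pow_unbounded_of_one_lt (|x - y|⁻¹) (by norm_num : (1 : ℝ) < 4)
  have h1 := pow_mul_abs_sub_lt_one (n := n) hx hy h
  have h2 := mul_lt_mul_of_pos_right hn hpos
  rw [inv_mul_cancel₀ hpos.ne'] at h2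
  linarith

/-! ### Tail equivalence under integer translation, inversion and negation. -/

theorem TailEquivalent.symm {x y : ℝ} (h : TailEquivalent x y) : TailEquivalent y x := by
  obtain ⟨m, n, h⟩ := h
  exact ⟨n, m, fun k => (h k).symm⟩

theorem TailEquivalent.trans {x y z : ℝ} (h : TailEquivalent x y) (h' : TailEquivalent y z) :
    TailEquivalent x z := by
  obtain ⟨m, n, h⟩ := h
  obtain ⟨p, q, h'⟩ := h'
  refine ⟨m + p, q + n, fun k => ?_⟩
  rw [add_assoc, h, add_assoc, ← h']
  congr 1
  omega

theorem TailEquivalent.refl (x : ℝ) : TailEquivalent x x := ⟨0, 0, fun _ => rfl⟩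

theorem tailEquivalent_iterate_cfStep {x : ℝ} (hx : Irrational x) (n : ℕ) :
    TailEquivalent x (cfStep^[n] x) :=
  ⟨n, 0, fun k => by rw [partialQuotient_iterate_cfStep hx, zero_add]⟩

theorem tailEquivalent_cfStep {x : ℝ} (hx : Irrational x) : TailEquivalent x (cfStep x) :=
  tailEquivalent_iterate_cfStep hx 1

theorem tailEquivalent_add_intCast {x : ℝ} (hx : Irrational x) (n : ℤ) :
    TailEquivalent x (x + n) := by
  have h : cfStep (x + n) = cfStep x := by simp [cfStep]
  refine (tailEquivalent_cfStep hx).trans ?_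
  rw [← h]
  exact (tailEquivalent_cfStep (hx.add_intCast n)).symm

theorem tailEquivalent_inv_of_pos {x : ℝ} (hx : Irrational x) (h0 : 0 < x) :
    TailEquivalent x x⁻¹ := by
  rcases lt_or_ge x 1 with h1 | h1
  · have h := tailEquivalent_cfStep hx
    rwa [cfStep, Int.fract_eq_self.2 ⟨h0.le, h1⟩] at h
  · have h1 : 1 < x := lt_of_le_of_ne h1 (fun h => hx ⟨1, by simpa using h⟩)
    have h := tailEquivalent_cfStep hx.inv
    rw [cfStep, Int.fract_eq_self.2 ⟨by positivity, inv_lt_one_of_one_lt₀ h1⟩, inv_inv] at h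
    exact h.symm

/-- With `x = a + 1/y`, one has `-x = -a - 1 + (1 - 1/y)` and `1 - 1/y = 1/(1 + 1/(y - 1))`, so
translations and inversions of positive numbers suffice. -/
theorem tailEquivalent_neg {x : ℝ} (hx : Irrational x) : TailEquivalent x (-x) := by
  have hy := hx.cfStep
  have hy1 := one_lt_cfStep hx
  set y := cfStep x with hydef
  have h1 : Irrational (y - 1) := by simpa using hy.sub_intCast 1
  have h2 : TailEquivalent y (y - 1) := by
    simpa [sub_eq_add_neg] using tailEquivalent_add_intCast hy (-1)
  have h3 := tailEquivalent_inv_of_pos h1 (by linarith)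
  have h4 : TailEquivalent (y - 1)⁻¹ ((y - 1)⁻¹ + 1) := by
    simpa using tailEquivalent_add_intCast h1.inv 1
  have h5 : Irrational ((y - 1)⁻¹ + 1) := by simpa using h1.inv.add_intCast 1
  have hpos : 0 < y - 1 := by linarith
  have h6 := tailEquivalent_inv_of_pos h5 (by positivity)
  have h7 := tailEquivalent_add_intCast h5.inv (-⌊x⌋ - 1)
  have h8 : ((y - 1)⁻¹ + 1)⁻¹ + ((-⌊x⌋ - 1 : ℤ) : ℝ) = -x := by
    have h9 : x = ⌊x⌋ + y⁻¹ := eq_floor_add_inv_cfStep x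
    have h10 : ((y - 1)⁻¹ + 1)⁻¹ = 1 - y⁻¹ := by
      have : (y - 1)⁻¹ + 1 = y / (y - 1) := by field_simp; ring
      rw [this]
      field_simp
    rw [h10]
    push_cast
    linarith
  rw [h8] at h7
  exact (tailEquivalent_cfStep hx).trans (h2.trans (h3.trans (h4.trans (h6.trans h7))))

theorem tailEquivalent_inv {x : ℝ} (hx : Irrational x) : TailEquivalent x x⁻¹ := by
  rcases lt_or_gt_of_ne hx.ne_zero with h | h
  · have h1 := tailEquivalent_inv_of_pos hx.neg (by linarith)
    have h2 := tailEquivalent_neg hx.neg.inv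
    rw [inv_neg, neg_neg] at h2
    rw [inv_neg] at h1
    exact (tailEquivalent_neg hx).trans (h1.trans h2)
  · exact tailEquivalent_inv_of_pos hx h

theorem tailEquivalent_neg_inv {x : ℝ} (hx : Irrational x) : TailEquivalent x (-x⁻¹) :=
  (tailEquivalent_inv hx).trans (tailEquivalent_neg hx.inv)

/-! ### Conjugate pairs described by rational sum and product. -/

open Polynomial

/-- `x` and `y` are conjugate quadratic irrationalities, expressed through their sum and product. -/
structure IsConjPair (x y : ℝ) : Prop where
  irrational : Irrational x
  ne : x ≠ y
  sum : ∃ p : ℚ, x + y = p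
  prod : ∃ q : ℚ, x * y = q

namespace IsConjPair

variable {x y z : ℝ}

theorem symm (h : IsConjPair x y) : IsConjPair y x where
  irrational := by
    obtain ⟨p, hp⟩ := h.sum
    rw [show y = p - x by linarith]
    exact h.irrational.ratCast_sub p
  ne := h.ne.symm
  sum := by rw [add_comm]; exact h.sum
  prod := by rw [mul_comm]; exact h.prod

/-- Two different partners would give `x = (q - q') / (p - p')`, a rational number. -/
theorem unique (h : IsConjPair x y) (h' : IsConjPair x z) : y = z := by
  obtain ⟨p, hp⟩ := h.sum
  obtain ⟨q, hq⟩ := h.prod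
  obtain ⟨p', hp'⟩ := h'.sum
  obtain ⟨q', hq'⟩ := h'.prod
  by_contra hne
  refine h.irrational ⟨(q - q') / (p - p'), ?_⟩
  have h1 : (p : ℝ) - p' = y - z := by linarith
  have h2 : (q : ℝ) - q' = x * (y - z) := by linarith
  push_cast
  rw [h1, h2, mul_div_cancel_right₀ _ (sub_ne_zero.2 hne)]

theorem add_ratCast (h : IsConjPair x y) (r : ℚ) : IsConjPair (x + r) (y + r) where
  irrational := h.irrational.add_ratCast r
  ne := fun e => h.ne (add_right_cancel e)
  sum := by
    obtain ⟨p, hp⟩ := h.sum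
    exact ⟨p + 2 * r, by push_cast; linarith⟩
  prod := by
    obtain ⟨p, hp⟩ := h.sum
    obtain ⟨q, hq⟩ := h.prod
    exact ⟨q + r * p + r * r, by push_cast; rw [← hp, ← hq]; ring⟩

theorem add_intCast (h : IsConjPair x y) (n : ℤ) : IsConjPair (x + n) (y + n) := by
  simpa using h.add_ratCast n

theorem sub_intCast (h : IsConjPair x y) (n : ℤ) : IsConjPair (x - n) (y - n) := by
  simpa [sub_eq_add_neg] using h.add_intCast (-n)

theorem inv (h : IsConjPair x y) : IsConjPair x⁻¹ y⁻¹ where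
  irrational := h.irrational.inv
  ne := fun e => h.ne (inv_injective e)
  sum := by
    obtain ⟨p, hp⟩ := h.sum
    obtain ⟨q, hq⟩ := h.prod
    refine ⟨p / q, ?_⟩
    have hx := h.irrational.ne_zero
    have hy := h.symm.irrational.ne_zero
    push_cast
    rw [← hp, ← hq]
    field_simp
    ring
  prod := by
    obtain ⟨q, hq⟩ := h.prod
    exact ⟨q⁻¹, by push_cast; rw [← hq, mul_inv]⟩

theorem cfStep (h : IsConjPair x y) : IsConjPair (cfStep x) (y - ⌊x⌋)⁻¹ :=
  (h.sub_intCast ⌊x⌋).inv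

theorem minpoly_eq (h : IsConjPair x y) {p q : ℚ} (hp : x + y = p) (hq : x * y = q) :
    minpoly ℚ x = X ^ 2 + (C (-p) * X + C q) := by
  have hd : (C (-p) * X + C q : ℚ[X]).degree < 2 :=
    lt_of_le_of_lt degree_linear_le (by norm_num)
  have hm : (X ^ 2 + (C (-p) * X + C q)).Monic := monic_X_pow_add hd
  have hev : aeval x (X ^ 2 + (C (-p) * X + C q)) = 0 := by
    simp only [map_add, map_mul, map_pow, aeval_X, aeval_C, eq_ratCast]
    push_cast
    rw [← hp, ← hq]
    ring
  have hint : IsIntegral ℚ x := ⟨_, hm, by rwa [← aeval_def]⟩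
  refine (eq_of_monic_of_dvd_of_natDegree_le (minpoly.monic hint) hm (minpoly.dvd ℚ x hev) ?_).symm
  have h2 : (X ^ 2 + (C (-p) * X + C q)).natDegree = 2 := by compute_degree!
  rw [h2, minpoly.two_le_natDegree_iff hint]
  rintro ⟨r, hr⟩
  exact h.irrational ⟨r, by simpa using hr⟩

theorem isQuadraticIrrationality (h : IsConjPair x y) : IsQuadraticIrrationality x := by
  obtain ⟨p, hp⟩ := h.sum
  obtain ⟨q, hq⟩ := h.prod
  rw [IsQuadraticIrrationality, h.minpoly_eq hp hq]
  compute_degree!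

theorem isQuadraticConjugate (h : IsConjPair x y) : IsQuadraticConjugate x y := by
  obtain ⟨p, hp⟩ := h.sum
  obtain ⟨q, hq⟩ := h.prod
  refine ⟨h.ne.symm, ?_⟩
  rw [isConjRoot_def, h.minpoly_eq hp hq,
    h.symm.minpoly_eq (by rw [add_comm]; exact hp) (by rw [mul_comm]; exact hq)]

end IsConjPair

theorem IsQuadraticIrrationality.irrational {x : ℝ} (h : IsQuadraticIrrationality x) :
    Irrational x := by
  rintro ⟨r, rfl⟩
  have h1 : (minpoly ℚ (algebraMap ℚ ℝ r)).natDegree = 2 := h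
  rw [minpoly.eq_X_sub_C, natDegree_X_sub_C] at h1
  omega

theorem IsQuadraticIrrationality.exists_sq_add_eq_zero {x : ℝ} (h : IsQuadraticIrrationality x) :
    ∃ b c : ℚ, minpoly ℚ x = X ^ 2 + C b * X + C c := by
  have hint : IsIntegral ℚ x := by
    by_contra hn
    rw [IsQuadraticIrrationality, minpoly.eq_zero hn] at h
    simp at h
  have h1 := eq_quadratic_of_degree_le_two (p := minpoly ℚ x)
    (natDegree_le_iff_degree_le.1 (le_of_eq h))
  have h2 : (minpoly ℚ x).coeff 2 = 1 := by
    have := minpoly.monic hint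
    rwa [Monic, leadingCoeff, h] at this
  rw [h2, C_1, one_mul] at h1
  exact ⟨_, _, h1⟩

theorem IsQuadraticIrrationality.isConjPair {x y : ℝ} (h : IsQuadraticIrrationality x)
    (h' : IsQuadraticConjugate x y) : IsConjPair x y := by
  obtain ⟨b, c, hbc⟩ := h.exists_sq_add_eq_zero
  have hx := minpoly.aeval ℚ x
  have hy := minpoly.aeval ℚ y
  rw [← isConjRoot_def.1 h'.2] at hy
  rw [hbc] at hx hy
  simp only [map_add, map_mul, map_pow, aeval_X, aeval_C, eq_ratCast] at hx hy
  have hsum : x + y = -b := by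
    have h1 : (y - x) * (x + y + b) = 0 := by linear_combination hy - hx
    rcases mul_eq_zero.1 h1 with h2 | h2
    · exact absurd (sub_eq_zero.1 h2) h'.1
    · linarith
  refine ⟨h.irrational, h'.1.symm, ⟨-b, by push_cast; exact hsum⟩, ⟨c, ?_⟩⟩
  rw [show y = -b - x by linarith]
  linear_combination -hx

theorem IsQuadraticIrrationality.exists_isConjPair {x : ℝ} (h : IsQuadraticIrrationality x) :
    ∃ y, IsConjPair x y := by
  obtain ⟨b, c, hbc⟩ := h.exists_sq_add_eq_zero
  have hx := minpoly.aeval ℚ x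
  rw [hbc] at hx
  simp only [map_add, map_mul, map_pow, aeval_X, aeval_C, eq_ratCast] at hx
  refine ⟨-b - x, h.irrational, fun e => h.irrational ⟨-b / 2, ?_⟩, ⟨-b, by push_cast; ring⟩,
    ⟨c, by linear_combination -hx⟩⟩
  push_cast
  linarith

theorem IsConjPair.sum_eq_zero_iff {x y : ℝ} (h : IsConjPair x y) :
    x + y = 0 ↔ ∃ q : ℚ, x ^ 2 = q := by
  obtain ⟨p, hp⟩ := h.sum
  obtain ⟨q, hq⟩ := h.prod
  constructor
  · intro h0
    exact ⟨-q, by push_cast; rw [← hq]; linear_combination x * h0⟩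
  · rintro ⟨r, hr⟩
    by_contra hne
    have hp0 : (p : ℝ) ≠ 0 := by rwa [← hp]
    refine h.irrational ⟨(r + q) / p, ?_⟩
    push_cast
    rw [div_eq_iff hp0, ← hr, ← hq, ← hp]
    ring

theorem IsConjPair.sum_eq_one_iff {x y : ℝ} (h : IsConjPair x y) :
    x + y = 1 ↔ ∃ q : ℚ, (x - 1 / 2) ^ 2 = q := by
  have h1 := (h.add_ratCast (-1 / 2)).sum_eq_zero_iff
  push_cast at h1
  rw [show x - 1 / 2 = x + -1 / 2 by ring, ← h1]
  constructor <;> intro h2 <;> linarith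

/-! ### Conjugates of the complete quotients and reducedness. -/

/-- The conjugates `yₙ` of the complete quotients `xₙ` of `x`, where `y₀ = y` is the conjugate
of `x`. -/
noncomputable def conjSeq (x y : ℝ) : ℕ → ℝ
  | 0 => y
  | n + 1 => (conjSeq x y n - partialQuotient x n)⁻¹

namespace IsConjPair

variable {x y : ℝ}

theorem conjSeq (h : IsConjPair x y) (n : ℕ) :
    IsConjPair (_root_.cfStep^[n] x) (_root_.conjSeq x y n) := by
  induction n with
  | zero => exact h
  | succ n ih =>
    rw [Function.iterate_succ_apply', _root_.conjSeq, partialQuotient_eq_floor h.irrational]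
    exact ih.cfStep

theorem conjSeq_sub_ne_zero (h : IsConjPair x y) (n : ℕ) :
    _root_.conjSeq x y n - partialQuotient x n ≠ 0 :=
  ((h.conjSeq n).symm.irrational.sub_intCast _).ne_zero

theorem conjSeq_succ_mem_Ioo (h : IsConjPair x y) {n : ℕ} (hn : 1 ≤ n)
    (h0 : _root_.conjSeq x y n < 0) : _root_.conjSeq x y (n + 1) ∈ Set.Ioo (-1 : ℝ) 0 := by
  obtain ⟨m, rfl⟩ := Nat.exists_eq_add_of_le' hn
  have h1 : (1 : ℝ) ≤ partialQuotient x (m + 1) := by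
    exact_mod_cast one_le_partialQuotient_succ h.irrational m
  rw [_root_.conjSeq]
  set d := _root_.conjSeq x y (m + 1) - partialQuotient x (m + 1) with hd
  have h2 : d < -1 := by linarith
  have h3 : (-d)⁻¹ < 1 := inv_lt_one_of_one_lt₀ (by linarith)
  rw [inv_neg] at h3
  exact ⟨by linarith, inv_lt_zero.2 (by linarith)⟩

theorem conjSeq_mem_Ioo_of_le (h : IsConjPair x y) {N n : ℕ} (hN : 1 ≤ N)
    (h0 : _root_.conjSeq x y N ∈ Set.Ioo (-1 : ℝ) 0) (hn : N ≤ n) :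
    _root_.conjSeq x y n ∈ Set.Ioo (-1 : ℝ) 0 := by
  induction n, hn using Nat.le_induction with
  | base => exact h0
  | succ n hn ih => exact h.conjSeq_succ_mem_Ioo (hN.trans hn) ih.2

/-- If all `yₙ` with `n ≥ 1` were positive, then `yₙ > aₙ ≥ 1`, so `yₙ - aₙ = 1/yₙ₊₁ < 1` and `aₙ`
is the floor of `yₙ`. Then `y₁` would have the same expansion as the first complete quotient of `x`,
against their being distinct. -/
theorem exists_conjSeq_neg (h : IsConjPair x y) : ∃ n, 1 ≤ n ∧ _root_.conjSeq x y n < 0 := by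
  by_contra! hcon
  have hirr := h.irrational
  have hpos : ∀ n, 1 ≤ n → 0 < _root_.conjSeq x y n := fun n hn =>
    lt_of_le_of_ne (hcon n hn) (h.conjSeq n).symm.irrational.ne_zero.symm
  have hgt : ∀ n, 1 ≤ n → (partialQuotient x n : ℝ) < _root_.conjSeq x y n := fun n hn => by
    have h1 := hpos (n + 1) (by omega)
    rw [_root_.conjSeq, inv_pos] at h1
    linarith
  have hfloor : ∀ n, 1 ≤ n → ⌊_root_.conjSeq x y n⌋ = partialQuotient x n := fun n hn => by
    rw [Int.floor_eq_iff]
    refine ⟨(hgt n hn).le, ?_⟩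
    by_contra! hle
    have h1 := hgt (n + 1) (by omega)
    have h2 : (1 : ℝ) ≤ partialQuotient x (n + 1) := by
      exact_mod_cast one_le_partialQuotient_succ hirr n
    have h3 : _root_.conjSeq x y (n + 1) ≤ 1 := by
      rw [_root_.conjSeq]
      exact inv_le_one_of_one_le₀ (by linarith)
    linarith
  have hiter : ∀ k, _root_.cfStep^[k] (_root_.conjSeq x y 1) = _root_.conjSeq x y (1 + k) := by
    intro k
    induction k with
    | zero => rfl
    | succ k ih =>
      rw [Function.iterate_succ_apply', ih, _root_.cfStep, Int.fract, hfloor _ (by omega),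
        ← add_assoc, _root_.conjSeq]
  refine (h.conjSeq 1).ne (eq_of_partialQuotient_eq (h.conjSeq 1).irrational
    (h.conjSeq 1).symm.irrational fun k => ?_)
  rw [partialQuotient_iterate_cfStep hirr, partialQuotient_eq_floor (h.conjSeq 1).symm.irrational,
    hiter, hfloor _ (by omega)]

/-- The complete quotients of a quadratic irrationality are eventually reduced. -/
theorem exists_forall_conjSeq_mem_Ioo (h : IsConjPair x y) :
    ∃ N, 1 ≤ N ∧ ∀ n, N ≤ n → _root_.conjSeq x y n ∈ Set.Ioo (-1 : ℝ) 0 := by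
  obtain ⟨n, hn, h0⟩ := h.exists_conjSeq_neg
  exact ⟨n + 1, by omega, fun m hm =>
    h.conjSeq_mem_Ioo_of_le (by omega) (h.conjSeq_succ_mem_Ioo hn h0) hm⟩

theorem tailEquivalent_conjSeq (h : IsConjPair x y) (n : ℕ) :
    TailEquivalent y (_root_.conjSeq x y n) := by
  induction n with
  | zero => exact .refl _
  | succ n ih =>
    have h1 := (h.conjSeq n).symm.irrational
    have h2 := tailEquivalent_add_intCast h1 (-partialQuotient x n)
    rw [Int.cast_neg, ← sub_eq_add_neg] at h2
    exact ih.trans (h2.trans (tailEquivalent_inv (h1.sub_intCast _)))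

end IsConjPair

/-! ### Integral quadratic equations and Lagrange's theorem. -/

/-- `x` and `y` are roots of the integral quadratic polynomial `a X² + b X + c`, of discriminant
`D`. -/
structure IsRootPair (D a b c : ℤ) (x y : ℝ) : Prop where
  ne_zero : a ≠ 0
  sum : (a : ℝ) * (x + y) = -b
  prod : (a : ℝ) * (x * y) = c
  discr : b ^ 2 - 4 * a * c = D

theorem IsConjPair.exists_isRootPair {x y : ℝ} (h : IsConjPair x y) :
    ∃ D a b c : ℤ, IsRootPair D a b c x y := by
  obtain ⟨p, hp⟩ := h.sum
  obtain ⟨q, hq⟩ := h.prod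
  refine ⟨_, p.den * q.den, -(p.num * q.den), q.num * p.den, ?_, ?_, ?_, rfl⟩
  · exact mul_ne_zero (by exact_mod_cast p.den_nz) (by exact_mod_cast q.den_nz)
  · have h1 : (p : ℝ) * p.den = p.num := by exact_mod_cast p.mul_den_eq_num
    rw [hp]
    push_cast
    rw [← h1]
    ring
  · have h1 : (q : ℝ) * q.den = q.num := by exact_mod_cast q.mul_den_eq_num
    rw [hq]
    push_cast
    rw [← h1]
    ring

/-- The substitution `X = n + 1/Z` preserves the discriminant; the new leading coefficient is the
value at `n`. -/
theorem IsRootPair.step {D a b c : ℤ} {x y : ℝ} (h : IsRootPair D a b c x y) (n : ℤ)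
    (hx : x - n ≠ 0) (hy : y - n ≠ 0) :
    IsRootPair D (a * n ^ 2 + b * n + c) (2 * a * n + b) a (x - n)⁻¹ (y - n)⁻¹ := by
  have ha : (a : ℝ) ≠ 0 := by exact_mod_cast h.ne_zero
  have h1 : ((a * n ^ 2 + b * n + c : ℤ) : ℝ) = a * ((x - n) * (y - n)) := by
    push_cast
    linear_combination -h.prod + n * h.sum
  refine ⟨?_, ?_, ?_, ?_⟩
  · intro h0
    rw [h0, Int.cast_zero] at h1
    exact mul_ne_zero ha (mul_ne_zero hx hy) h1.symm
  · rw [h1]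
    field_simp
    push_cast
    linear_combination h.sum
  · rw [h1]
    field_simp
  · rw [← h.discr]
    ring

theorem IsConjPair.exists_isRootPair_conjSeq {D a b c : ℤ} {x y : ℝ} (h : IsConjPair x y)
    (h' : IsRootPair D a b c x y) (n : ℕ) :
    ∃ a b c : ℤ, IsRootPair D a b c (_root_.cfStep^[n] x) (_root_.conjSeq x y n) := by
  induction n with
  | zero => exact ⟨a, b, c, h'⟩
  | succ n ih =>
    obtain ⟨a, b, c, ih⟩ := ih
    have h1 := ih.step (partialQuotient x n)
      ((h.conjSeq n).irrational.sub_intCast _).ne_zero (h.conjSeq_sub_ne_zero n)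
    rw [partialQuotient_eq_floor h.irrational] at h1
    rw [Function.iterate_succ_apply', _root_.conjSeq, partialQuotient_eq_floor h.irrational]
    exact ⟨_, _, _, h1⟩

/-- Roots of opposite sign force `ac < 0`, so `D = b² + 4|ac|` bounds every coefficient. -/
theorem IsRootPair.mem_Icc {D a b c : ℤ} {x y : ℝ} (h : IsRootPair D a b c x y) (hx : 0 < x)
    (hy : y < 0) : a ∈ Set.Icc (-D) D ∧ b ∈ Set.Icc (-D) D ∧ c ∈ Set.Icc (-D) D := by
  have ha : (a : ℝ) ≠ 0 := by exact_mod_cast h.ne_zero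
  have h1 : ((a * c : ℤ) : ℝ) < 0 := by
    push_cast
    rw [← h.prod]
    have := mul_pos hx (neg_pos.2 hy)
    nlinarith [mul_pos (sq_pos_of_ne_zero ha) this]
  have h2 : a * c < 0 := by exact_mod_cast h1
  have h3 := h.discr
  have hc : c ≠ 0 := by rintro rfl; simp at h2
  have key : |a| * |c| = -(a * c) := by rw [← abs_mul, abs_of_neg h2]
  have ha1 : 1 ≤ |a| := Int.one_le_abs h.ne_zero
  have hc1 : 1 ≤ |c| := Int.one_le_abs hc
  simp only [Set.mem_Icc, ← abs_le]
  refine ⟨by nlinarith [sq_nonneg b], ?_, by nlinarith [sq_nonneg b]⟩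
  nlinarith [sq_abs b, abs_nonneg b, sq_nonneg (|b| - 1)]

theorem IsRootPair.eq_of_pos {D D' a b c : ℤ} {x y x' y' : ℝ} (h : IsRootPair D a b c x y)
    (h' : IsRootPair D' a b c x' y') (hx' : 0 < x') (hy : y < 0) : x = x' := by
  have ha : (a : ℝ) ≠ 0 := by exact_mod_cast h.ne_zero
  have h1 : x + y = x' + y' := mul_left_cancel₀ ha (by rw [h.sum, h'.sum])
  have h2 : x * y = x' * y' := mul_left_cancel₀ ha (by rw [h.prod, h'.prod])
  have h3 : (x' - x) * (x' - y) = 0 := by linear_combination h2 - x' * h1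
  rcases mul_eq_zero.1 h3 with h4 | h4 <;> linarith

/-- Lagrange's theorem: some complete quotient of a quadratic irrationality comes back. -/
theorem IsConjPair.exists_iterate_cfStep_eq {x y : ℝ} (h : IsConjPair x y) :
    ∃ s t : ℕ, 0 < t ∧ _root_.cfStep^[s + t] x = _root_.cfStep^[s] x := by
  obtain ⟨D, a, b, c, hr⟩ := h.exists_isRootPair
  obtain ⟨N, hN, hred⟩ := h.exists_forall_conjSeq_mem_Ioo
  choose A B C hABC using h.exists_isRootPair_conjSeq hr
  have hpos : ∀ n, 0 < _root_.cfStep^[N + n] x := fun n => by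
    obtain ⟨m, rfl⟩ := Nat.exists_eq_add_of_le' hN
    rw [show m + 1 + n = m + n + 1 by omega, Function.iterate_succ_apply']
    exact one_pos.trans (one_lt_cfStep (h.irrational.iterate_cfStep _))
  have hneg : ∀ n, _root_.conjSeq x y (N + n) < 0 := fun n => (hred _ (by omega)).2
  -- Pigeonhole: from index `N` on, the coefficient triples lie in a finite set, and a triple
  -- determines its positive root.
  let f : ℕ → Set.Icc (-D) D × Set.Icc (-D) D × Set.Icc (-D) D := fun n =>
    have hm := (hABC (N + n)).mem_Icc (hpos n) (hneg n)
    (⟨_, hm.1⟩, ⟨_, hm.2.1⟩, ⟨_, hm.2.2⟩)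
  obtain ⟨i, j, hij, hf⟩ := Finite.exists_ne_map_eq_of_infinite f
  have heq : _root_.cfStep^[N + i] x = _root_.cfStep^[N + j] x := by
    simp only [f, Prod.mk.injEq, Subtype.mk.injEq] at hf
    have h1 := hABC (N + j)
    rw [← hf.1, ← hf.2.1, ← hf.2.2] at h1
    exact (hABC (N + i)).eq_of_pos h1 (hpos j) (hneg i)
  rcases lt_or_gt_of_ne hij with hlt | hlt
  · exact ⟨N + i, j - i, by omega, by rw [show N + i + (j - i) = N + j by omega, heq]⟩
  · exact ⟨N + j, i - j, by omega, by rw [show N + j + (i - j) = N + i by omega, heq]⟩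

/-! ### Two-sided periodic sequences and their symmetries. -/

/-- The periodic two-sided sequence `w` agrees with a tail of the sequence `u`. -/
structure IsPeriodicTail (u : ℕ → ℤ) (w : ℤ → ℤ) (t : ℕ) (s : ℕ) : Prop where
  pos : 0 < t
  periodic : Function.Periodic w t
  eq : ∀ k : ℕ, u (s + k) = w k

theorem Function.Periodic.eq_of_forall_natCast {w w' : ℤ → ℤ} {t : ℕ} (ht : 0 < t)
    (hw : Function.Periodic w t) (hw' : Function.Periodic w' t) (N : ℕ)
    (h : ∀ k : ℕ, N ≤ k → w k = w' k) (j : ℤ) : w j = w' j := by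
  have h0 : 0 ≤ j + (N + |j|) * t := by
    have : (1 : ℤ) ≤ t := by exact_mod_cast ht
    nlinarith [neg_abs_le j, abs_nonneg j, mul_nonneg (Nat.cast_nonneg (α := ℤ) N)
      (Nat.cast_nonneg (α := ℤ) t)]
  have h1 : (N : ℤ) ≤ j + (N + |j|) * t := by
    have : (1 : ℤ) ≤ t := by exact_mod_cast ht
    nlinarith [neg_abs_le j, abs_nonneg j, mul_nonneg (Nat.cast_nonneg (α := ℤ) N)
      (sub_nonneg.2 this)]
  -- Adding `N + |j|` periods moves the index `j` beyond `N`.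
  rw [← hw.int_mul (N + |j|) j, ← hw'.int_mul (N + |j|) j]
  obtain ⟨m, hm⟩ := Int.eq_ofNat_of_zero_le h0
  push_cast at *
  rw [hm]
  exact h m (by omega)

theorem exists_isPeriodicTail {u : ℕ → ℤ} {s t : ℕ} (ht : 0 < t)
    (h : ∀ k, s ≤ k → u (k + t) = u k) :
    ∃ w, IsPeriodicTail u w t s := by
  refine ⟨fun k => u (s + (k % t).toNat), ht, fun k => by simp, fun k => ?_⟩
  · have h1 : ∀ q r : ℕ, u (s + (r + t * q)) = u (s + r) := by
      intro q r
      induction q with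
      | zero => simp
      | succ q ih => rw [← ih, ← h (s + (r + t * q)) (by omega)]; congr 1; ring
    have h2 := h1 (k / t) (k % t)
    rw [Nat.mod_add_div] at h2
    rw [h2]
    congr 1

namespace IsPeriodicTail

variable {u : ℕ → ℤ} {w : ℤ → ℤ} {t s : ℕ}

theorem exists_shift (h : IsPeriodicTail u w t s) (j : ℤ) :
    ∃ s', IsPeriodicTail u (fun k => w (k + j)) t s' := by
  have h0 : 0 ≤ j + |j| * t := by
    have : (1 : ℤ) ≤ t := by exact_mod_cast h.pos
    nlinarith [neg_abs_le j, abs_nonneg j]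
  obtain ⟨m, hm⟩ := Int.eq_ofNat_of_zero_le h0
  refine ⟨s + m, h.pos, fun k => ?_, fun k => ?_⟩
  · rw [add_right_comm]
    exact h.periodic _
  · rw [add_assoc, h.eq, ← h.periodic.int_mul |j| (k + j)]
    congr 1
    push_cast
    rw [add_assoc]
    omega

/-- Rotation by `r` matches `w (i + r)` with `w (t - 1 - i) = w (-1 - i)`; these indices sum to `r -
1`, and periodicity removes the bound on `i`. -/
theorem exists_symmetric (h : IsPeriodicTail u w t s) {r : ℕ}
    (hr : (List.ofFn fun i : Fin t => w i).rotate r = (List.ofFn fun i : Fin t => w i).reverse) :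
    ∀ k, w (r - 1 - k) = w k := by
  have h1 : ∀ i : ℕ, i < t → w (i + r) = w (-1 - i) := by
    intro i hi
    have h2 := List.getElem_of_eq hr (i := i) (by simpa using hi)
    rw [List.getElem_rotate, List.getElem_reverse] at h2
    simp only [List.getElem_ofFn, List.length_ofFn] at h2
    rw [← h.periodic (-1 - i)]
    have h3 : ((t - 1 - i : ℕ) : ℤ) = -1 - i + t := by omega
    rw [← h3, ← h2]
    have h4 := h.periodic.int_mul ((i + r : ℕ) / t : ℤ) ((i + r : ℕ) % t : ℤ)
    have h5 := Int.emod_add_ediv_mul (i + r : ℕ) (t : ℤ)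
    push_cast at h4 h5 ⊢
    rw [h5] at h4
    exact h4
  intro k
  have ht : (0 : ℤ) < t := by exact_mod_cast h.pos
  obtain ⟨i, hi⟩ := Int.eq_ofNat_of_zero_le (Int.emod_nonneg (k - r) ht.ne')
  have hlt := Int.emod_lt_of_pos (k - r) ht
  have h5 := Int.emod_add_ediv_mul (k - r) (t : ℤ)
  set q := (k - r) / (t : ℤ)
  have h6 : k = i + r + q * t := by linarith
  have h7 := h1 i (by omega)
  have h8 := h.periodic.int_mul q (i + r)
  have h9 := h.periodic.int_mul (-q) (-1 - i)
  push_cast at h8 h9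
  rw [h6, h8, h7, ← h9]
  congr 1
  ring

theorem rotate_ofFn (h : IsPeriodicTail u w t s) {c : ℤ} (hc : ∀ k, w (c - k) = w k) :
    (List.ofFn fun i : Fin t => w i).rotate ((c + 1) % t).toNat =
      (List.ofFn fun i : Fin t => w i).reverse := by
  have ht : (0 : ℤ) < t := by exact_mod_cast h.pos
  obtain ⟨r, hr⟩ := Int.eq_ofNat_of_zero_le (Int.emod_nonneg (c + 1) ht.ne')
  have h5 := Int.emod_add_ediv_mul (c + 1) (t : ℤ)
  set q := (c + 1) / (t : ℤ)
  rw [hr] at h5 ⊢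
  refine List.ext_getElem (by simp) fun i hi _ => ?_
  simp only [List.length_rotate, List.length_ofFn] at hi
  rw [List.getElem_rotate, List.getElem_reverse]
  simp only [List.getElem_ofFn, List.length_ofFn]
  have h3 : ((t - 1 - i : ℕ) : ℤ) = -1 - i + t := by omega
  have h6 := h.periodic.int_mul ((i + r : ℕ) / t : ℤ) ((i + r : ℕ) % t : ℤ)
  have h7 := Int.emod_add_ediv_mul (i + r : ℕ) (t : ℤ)
  have h8 := h.periodic.int_mul q (i + r)
  rw [h3, h.periodic, ← hc (-1 - i)]
  push_cast at h6 h7 h8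
  rw [h7] at h6
  rw [Int.toNat_natCast, Int.natCast_mod, Nat.cast_add, ← h6, ← h8]
  congr 1
  linarith

end IsPeriodicTail

/-- A sequence has a cyclic palindromic period if and only if it has a tail which extends to a
periodic two-sided sequence with a centre of symmetry. -/
theorem hasCyclicPalindromicPeriod_iff {x : ℝ} : HasCyclicPalindromicPeriod x ↔
    ∃ (w : ℤ → ℤ) (t s : ℕ) (c : ℤ), IsPeriodicTail (partialQuotient x) w t s ∧
      ∀ k, w (c - k) = w k := by
  constructor
  · rintro ⟨_, ⟨s, t, ht, hper, rfl⟩, r, hr⟩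
    obtain ⟨w, h⟩ := exists_isPeriodicTail ht hper
    simp only [h.eq] at hr
    exact ⟨_, t, s, r - 1, h, h.exists_symmetric hr⟩
  · rintro ⟨w, t, s, c, h, hc⟩
    refine ⟨_, ⟨s, t, h.pos, fun k hk => ?_, rfl⟩, ((c + 1) % t).toNat, ?_⟩
    · obtain ⟨k, rfl⟩ := Nat.exists_eq_add_of_le hk
      rw [add_assoc, h.eq, h.eq]
      exact_mod_cast h.periodic k
    · simp only [h.eq]
      exact h.rotate_ofFn hc

theorem HasCyclicPalindromicPeriod.of_tailEquivalent {x y : ℝ} (h : HasCyclicPalindromicPeriod x)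
    (hxy : TailEquivalent y x) : HasCyclicPalindromicPeriod y := by
  rw [hasCyclicPalindromicPeriod_iff] at h ⊢
  obtain ⟨w, t, s, c, h, hc⟩ := h
  obtain ⟨m, n, hmn⟩ := hxy
  -- Shifting the origin by `n` lowers the sum of mirrored indices by `2n`.
  refine ⟨fun k => w (k + n), t, m + s, c - 2 * n, ⟨h.pos, fun k => ?_, fun k => ?_⟩, fun k => ?_⟩
  · rw [add_right_comm]
    exact h.periodic _
  · rw [add_assoc, hmn, show n + (s + k) = s + (k + n) by ring, h.eq]
    push_cast
    rfl
  · show w _ = w _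
    rw [← hc]
    congr 1
    ring

/-! ### Galois' theorem and the reversed period. -/

/-- Galois' theorem: the continued fraction of `-1 / y`, where `y` is the conjugate of a number with
a purely periodic continued fraction, is obtained by reading backwards. -/
theorem IsConjPair.partialQuotient_neg_inv {x y : ℝ} (h : IsConjPair x y) {w : ℤ → ℤ} {t : ℕ}
    (hw : IsPeriodicTail (partialQuotient x) w t 0) (k : ℕ) :
    partialQuotient (-y⁻¹) k = w (-1 - k) := by
  have heq : ∀ n : ℕ, partialQuotient x n = w n := fun n => by rw [← hw.eq, zero_add]
  have hirr := h.irrational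
  have hx : ∀ n : ℕ, _root_.cfStep^[n * t] x = x := fun n => by
    refine eq_of_partialQuotient_eq (hirr.iterate_cfStep _) hirr fun k => ?_
    rw [partialQuotient_iterate_cfStep hirr, heq, heq]
    have := hw.periodic.int_mul n k
    push_cast at this ⊢
    rw [add_comm, this]
  have hy : ∀ n : ℕ, _root_.conjSeq x y (n * t) = y := fun n => by
    have h1 := h.conjSeq (n * t)
    rw [hx n] at h1
    exact h1.unique h
  obtain ⟨N, hN, hred⟩ := h.exists_forall_conjSeq_mem_Ioo
  have hmod : ∀ n q : ℕ, _root_.conjSeq x y (n + q * t) = _root_.conjSeq x y n := fun n q => by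
    have h1 := h.conjSeq (n + q * t)
    rw [Function.iterate_add_apply, hx q] at h1
    exact h1.unique (h.conjSeq n)
  -- Pure periodicity carries reducedness from large indices back to all indices.
  have hall : ∀ n, _root_.conjSeq x y n ∈ Set.Ioo (-1 : ℝ) 0 := fun n => by
    rw [← hmod n N]
    exact hred _ (le_add_left (Nat.le_mul_of_pos_right N hw.pos))
  -- Since `-yₙ` lies in `(0, 1)`, this exhibits floor `aₙ` and next complete quotient `-1/yₙ`: the
  -- algorithm runs through the indices downwards.
  have hstep : ∀ n, -(_root_.conjSeq x y (n + 1))⁻¹ = partialQuotient x n + -_root_.conjSeq x y n := fun n => by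
    rw [_root_.conjSeq, inv_inv]
    ring
  have hfloor : ∀ n, ⌊-(_root_.conjSeq x y (n + 1))⁻¹⌋ = partialQuotient x n := fun n => by
    rw [hstep, Int.floor_intCast_add, add_eq_left, Int.floor_eq_zero_iff]
    have := hall n
    exact ⟨by linarith [this.2], by linarith [this.1]⟩
  have hcf : ∀ n, _root_.cfStep (-(_root_.conjSeq x y (n + 1))⁻¹) = -(_root_.conjSeq x y n)⁻¹ := fun n => by
    rw [_root_.cfStep, Int.fract, hfloor, hstep, add_sub_cancel_left, inv_neg]
  have hiter : ∀ k n, _root_.cfStep^[k] (-(_root_.conjSeq x y (n + k))⁻¹) = -(_root_.conjSeq x y n)⁻¹ := by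
    intro k
    induction k with
    | zero => intro n; rfl
    | succ k ih => intro n; rw [Function.iterate_succ_apply, ← add_assoc, hcf, ih]
  -- Starting from `y = y₍ₖ₊₁₎ₜ` leaves room for `k` downward steps and one more floor.
  have hle : k + 1 ≤ (k + 1) * t := Nat.le_mul_of_pos_right _ hw.pos
  obtain ⟨m, hm⟩ := Nat.exists_eq_add_of_le' hle
  rw [← hy (k + 1), hm, partialQuotient_eq_floor (h.conjSeq _).symm.irrational.inv.neg,
    show m + (k + 1) = m + 1 + k by ring, hiter, hfloor, heq]
  have h1 := hw.periodic.int_mul (k + 1 : ℕ) (-1 - k)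
  rw [← h1]
  congr 1
  have h2 : (((k + 1) * t : ℕ) : ℤ) = m + (k + 1) := by rw [hm]; push_cast; rfl
  push_cast at h2 ⊢
  linarith

/-- The number `-1/yₛ` reads `w` backwards and is tail equivalent to `y`, hence to `x`; so `w`
agrees with a shifted reversal of itself on a tail, hence everywhere. -/
theorem IsConjPair.hasCyclicPalindromicPeriod {x y : ℝ} (h : IsConjPair x y)
    (hxy : TailEquivalent x y) : HasCyclicPalindromicPeriod x := by
  obtain ⟨s, t, ht, hst⟩ := h.exists_iterate_cfStep_eq
  have hirr := h.irrational
  have hper : ∀ k, s ≤ k → partialQuotient x (k + t) = partialQuotient x k := fun k hk => by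
    obtain ⟨k, rfl⟩ := Nat.exists_eq_add_of_le hk
    rw [add_right_comm, ← partialQuotient_iterate_cfStep hirr, hst,
      partialQuotient_iterate_cfStep hirr]
  obtain ⟨w, hw⟩ := exists_isPeriodicTail ht hper
  have hs := h.conjSeq s
  have hrev := hs.partialQuotient_neg_inv (w := w) (t := t) ⟨ht, hw.periodic, fun k => by
    rw [partialQuotient_iterate_cfStep hirr, zero_add, hw.eq]⟩
  obtain ⟨m, n, hmn⟩ := hxy.trans ((h.tailEquivalent_conjSeq s).trans
    (tailEquivalent_neg_inv hs.symm.irrational))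
  rw [hasCyclicPalindromicPeriod_iff]
  -- The matching tails give `w (m - s + k) = w (-1 - n - k)`; the centre is the sum of these
  -- indices.
  refine ⟨w, t, s, m - s - n - 1, hw, fun k => ?_⟩
  have key := Function.Periodic.eq_of_forall_natCast (w := fun k => w (m - s + k))
    (w' := fun k => w (-1 - n - k)) ht (fun k => by simp only [← add_assoc]; exact hw.periodic _)
    (fun k => by
      show w _ = w _
      rw [← hw.periodic]
      congr 1
      ring) s (fun k hk => by
      have h1 := hmn k
      obtain ⟨j, rfl⟩ := Nat.exists_eq_add_of_le hk
      rw [hrev, show m + (s + j) = s + (m + j) by ring, hw.eq] at h1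
      push_cast at h1
      convert h1 using 2 <;> push_cast <;> ring) (-1 - n - k)
  rw [show (m : ℤ) - s - n - 1 - k = m - s + (-1 - n - k) by ring, key]
  congr 1
  ring

/-! ### The four relations and the theorem. -/

theorem IsConjPair.tailEquivalent_of_relation {x y : ℝ} (h : IsConjPair x y)
    (hxy : x + y = 0 ∨ x + y = 1 ∨ x * y = 1 ∨ x * y = -1) : TailEquivalent x y := by
  have hirr := h.irrational
  have hx0 := hirr.ne_zero
  rcases hxy with hxy | hxy | hxy | hxy
  · rw [show y = -x by linarith]
    exact tailEquivalent_neg hirr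
  · rw [show y = -x + (1 : ℤ) by push_cast; linarith]
    exact (tailEquivalent_neg hirr).trans (tailEquivalent_add_intCast hirr.neg 1)
  · rw [show y = x⁻¹ by field_simp; linarith]
    exact tailEquivalent_inv hirr
  · rw [show y = -x⁻¹ by field_simp; linarith]
    exact tailEquivalent_neg_inv hirr

theorem tailEquivalentToSome_iff {x : ℝ} {P : ℝ → ℝ → Prop} : TailEquivalentToSome x P ↔
    ∃ ω ω', IsConjPair ω ω' ∧ TailEquivalent x ω ∧ P ω ω' :=
  ⟨fun ⟨ω, ω', h1, h2, h3, h4⟩ => ⟨ω, ω', h1.isConjPair h2, h3, h4⟩,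
    fun ⟨ω, ω', h1, h2, h3⟩ =>
      ⟨ω, ω', h1.isQuadraticIrrationality, h1.isQuadraticConjugate, h2, h3⟩⟩

/-- Translating by `-j` changes the sum by `-2j`, so only the parity of `c` matters. -/
theorem IsConjPair.tailEquivalentToSome_of_sum_eq_intCast {x ω ω' : ℝ} (h : IsConjPair ω ω')
    (hx : TailEquivalent x ω) {c : ℤ} (hc : ω + ω' = c) :
    TailEquivalentToSome x (fun ω ω' => ω + ω' = 0) ∨
      TailEquivalentToSome x (fun ω ω' => ω + ω' = 1) := by
  simp only [tailEquivalentToSome_iff]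
  rcases Int.even_or_odd' c with ⟨j, rfl | rfl⟩
  · refine .inl ⟨_, _, h.add_intCast (-j),
      hx.trans (tailEquivalent_add_intCast h.irrational _), ?_⟩
    push_cast at hc ⊢
    linarith
  · refine .inr ⟨_, _, h.add_intCast (-j),
      hx.trans (tailEquivalent_add_intCast h.irrational _), ?_⟩
    push_cast at hc ⊢
    linarith

theorem HasCyclicPalindromicPeriod.tailEquivalentToSome {x y : ℝ} (hxy : IsConjPair x y)
    (h : HasCyclicPalindromicPeriod x) :
    TailEquivalentToSome x (fun ω ω' => ω + ω' = 0) ∨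
      TailEquivalentToSome x (fun ω ω' => ω + ω' = 1) ∨
      TailEquivalentToSome x (fun ω ω' => ω * ω' = -1) := by
  obtain ⟨w, t, s, c, h, hc⟩ := hasCyclicPalindromicPeriod_iff.1 h
  have hirr := hxy.irrational
  rcases Int.even_or_odd' c with ⟨j, rfl | rfl⟩
  -- The symmetry now fixes index 0, so reading backwards from `-1` agrees with reading forwards
  -- from `1`.
  · obtain ⟨s', h'⟩ := h.exists_shift j
    have hs := hxy.conjSeq s'
    have ht := tailEquivalent_iterate_cfStep hirr s'
    have hw : ∀ k : ℕ, partialQuotient (cfStep^[s'] x) k = w (k + j) := fun k => by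
      rw [partialQuotient_iterate_cfStep hirr, h'.eq]
    have hrev := hs.partialQuotient_neg_inv (w := fun k => w (k + j)) (t := t)
      ⟨h'.pos, h'.periodic, fun k => by rw [zero_add, hw]⟩
    have heq := eq_of_partialQuotient_eq hs.irrational.cfStep hs.symm.irrational.inv.neg fun k => by
      have h1 := partialQuotient_iterate_cfStep hs.irrational 1 k
      rw [Function.iterate_one] at h1
      rw [hrev, h1, hw, ← hc]
      congr 1
      push_cast
      ring
    have hsum : cfStep^[s'] x + conjSeq x y s' = ⌊cfStep^[s'] x⌋ := by
      have h1 := eq_floor_add_inv_cfStep (cfStep^[s'] x)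
      rw [heq, inv_neg, inv_inv] at h1
      linarith
    rcases hs.tailEquivalentToSome_of_sum_eq_intCast ht hsum with h1 | h1
    · exact .inl h1
    · exact .inr (.inl h1)
  -- The symmetry now exchanges `-1` and `0`, so both readings agree without dropping an entry.
  · obtain ⟨s', h'⟩ := h.exists_shift (j + 1)
    have hs := hxy.conjSeq s'
    have ht := tailEquivalent_iterate_cfStep hirr s'
    have hw : ∀ k : ℕ, partialQuotient (cfStep^[s'] x) k = w (k + (j + 1)) := fun k => by
      rw [partialQuotient_iterate_cfStep hirr, h'.eq]
    have hrev := hs.partialQuotient_neg_inv (w := fun k => w (k + (j + 1))) (t := t)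
      ⟨h'.pos, h'.periodic, fun k => by rw [zero_add, hw]⟩
    have heq := eq_of_partialQuotient_eq hs.irrational hs.symm.irrational.inv.neg fun k => by
      rw [hrev, hw, ← hc]
      congr 1
      ring
    refine .inr (.inr (tailEquivalentToSome_iff.2 ⟨_, _, hs, ht, ?_⟩))
    have h0 := hs.symm.irrational.ne_zero
    rw [heq]
    field_simp

theorem HasCyclicPalindromicPeriod.of_tailEquivalentToSome {x : ℝ} {P : ℝ → ℝ → Prop}
    (hP : ∀ a b, P a b → a + b = 0 ∨ a + b = 1 ∨ a * b = 1 ∨ a * b = -1)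
    (h : TailEquivalentToSome x P) : HasCyclicPalindromicPeriod x := by
  obtain ⟨ω, ω', h1, h2, h3⟩ := tailEquivalentToSome_iff.1 h
  exact (h1.hasCyclicPalindromicPeriod (h1.tailEquivalent_of_relation (hP _ _ h3))).of_tailEquivalent
    h2

/-- The map `z ↦ 1/(z - 1) + 1 = z/(z - 1)` is an involution preserving tails. The product of the
images is 1 exactly when `ω + ω' = 1`, so it exchanges the two relations. -/
theorem tailEquivalentToSome_add_eq_one_iff {x : ℝ} :
    TailEquivalentToSome x (fun ω ω' => ω + ω' = 1) ↔
      TailEquivalentToSome x (fun ω ω' => ω * ω' = 1) := by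
  have hconj : ∀ {a b : ℝ}, IsConjPair a b → IsConjPair ((a - 1)⁻¹ + 1) ((b - 1)⁻¹ + 1) :=
    fun h => by simpa using (h.sub_intCast 1).inv.add_intCast 1
  have htail : ∀ {a : ℝ}, Irrational a → TailEquivalent a ((a - 1)⁻¹ + 1) := fun {a} h => by
    have h1 : Irrational (a - 1) := by simpa using h.sub_intCast 1
    have h2 := tailEquivalent_add_intCast h (-1)
    have h3 := tailEquivalent_add_intCast h1.inv 1
    simp only [Int.cast_neg, Int.cast_one, ← sub_eq_add_neg] at h2 h3
    exact h2.trans ((tailEquivalent_inv h1).trans h3)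
  have hne : ∀ {a : ℝ}, Irrational a → a - 1 ≠ 0 := fun h => by
    simpa using (h.sub_intCast 1).ne_zero
  simp only [tailEquivalentToSome_iff]
  constructor
  · rintro ⟨ω, ω', h, hx, hsum⟩
    refine ⟨_, _, hconj h, hx.trans (htail h.irrational), ?_⟩
    have h1 := hne h.irrational
    have h2 := hne h.symm.irrational
    field_simp
    linear_combination hsum
  · rintro ⟨ω, ω', h, hx, hprod⟩
    refine ⟨_, _, hconj h, hx.trans (htail h.irrational), ?_⟩
    have h1 := hne h.irrational
    have h2 := hne h.symm.irrational
    field_simp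
    linear_combination hprod

theorem mainTheorem1 (α : ℝ) (hα : IsQuadraticIrrationality α) :
    (HasCyclicPalindromicPeriod α ↔
      (TailEquivalentToSome α (fun ω ω' => ω + ω' = 0) ∨
        TailEquivalentToSome α (fun ω ω' => ω + ω' = 1) ∨
        TailEquivalentToSome α (fun ω ω' => ω * ω' = 1) ∨
        TailEquivalentToSome α (fun ω ω' => ω * ω' = -1))) ∧
    (TailEquivalentToSome α (fun ω ω' => ω + ω' = 1) ↔
      TailEquivalentToSome α (fun ω ω' => ω * ω' = 1)) ∧
    (∀ ω ω' : ℝ, IsQuadraticIrrationality ω → IsQuadraticConjugate ω ω' →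
      ((ω + ω' = 0 ↔ ∃ q : ℚ, ω ^ 2 = (q : ℝ)) ∧
        (ω + ω' = 1 ↔ ∃ q : ℚ, (ω - 1 / 2) ^ 2 = (q : ℝ)))) := by
  obtain ⟨β, hβ⟩ := hα.exists_isConjPair
  refine ⟨⟨fun h => ?_, ?_⟩, tailEquivalentToSome_add_eq_one_iff, fun ω ω' h h' =>
    ⟨(h.isConjPair h').sum_eq_zero_iff, (h.isConjPair h').sum_eq_one_iff⟩⟩
  -- A centre of symmetry yields only (a), (b) or (d); (c) is not needed in this direction.
  · rcases h.tailEquivalentToSome hβ with h1 | h1 | h1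
    · exact .inl h1
    · exact .inr (.inl h1)
    · exact .inr (.inr (.inr h1))
  · rintro (h | h | h | h)
    · exact .of_tailEquivalentToSome (fun _ _ => .inl) h
    · exact .of_tailEquivalentToSome (fun _ _ h => .inr (.inl h)) h
    · exact .of_tailEquivalentToSome (fun _ _ h => .inr (.inr (.inl h))) h
    · exact .of_tailEquivalentToSome (fun _ _ h => .inr (.inr (.inr h))) h
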